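/- Consider the sale of one indivisible good to two risk-neutral bidders whose values lie in $[0,1]$. A (direct) mechanism consists of Borel allocation probabilities $q_1,q_2:[0,1]^2\to[0,1]$ with $q_1+q_2\le 1$ and Borel payments $t_1,t_2:[0,1]^2\to\mathbb{R}$. It is dominant strategy incentive compatible (DSIC) if $v_iq_i(v)-t_i(v)\ge v_iq_i(v_i',v_{-i})-t_i(v_i',v_{-i})$ for all $i$, $v$, $v_i'$, and ex-post individually rational (EPIR) if $v_iq_i(v)-t_i(v)\ge 0$ for all $i$, $v$. For a Borel probability measure $F$ on $[0,1]$ (atoms are allowed), let $\Pi(F)$ be the set of Borel probability measures on $[0,1]^2$ both of whose marginals are $F$. A maxmin auction among DSIC and EPIR mechanisms is a DSIC and EPIR mechanism that maximizes, among all such mechanisms, the worst-case expected revenue $\inf_{\pi\in\Pi(F)}\int (t_1+t_2)\,d\pi\in[-\infty,\infty)$. The Second Price Auction with Uniformly Distributed Reserves is the mechanism in which, if $v_i>v_j$, $q_i=v_i$, $q_j=0$, $t_i=\frac{v_1^2+v_2^2}{2}$, $t_j=0$, and if $v_1=v_2=v$, $q_1=q_2=\frac v2$, $t_1=t_2=\frac{v^2}{2}$.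 Proposition. Let $F$ be a Borel probability measure on $[0,1]$. If the Second Price Auction with Uniformly Distributed Reserves is a maxmin auction among DSIC and EPIR mechanisms for two bidders with common marginal distribution $F$, then the robust-version regularity conditions hold almost surely, that is: $F$ restricted to $(0,1)$ has a density $f$ with respect to Lebesgue measure, and, after modification of $f$ on a Lebesgue null set, $x^2f(x)$ is non-decreasing on $(0,1)$, and $F(\{1\})\ge\int_{(0,1)}x^2f(x)\,dx$. -/

import Mathlib

open MeasureTheory Set

noncomputable section

namespace RobustAuction

/-- Valuations and bids lie in `[0, 1]`; a value profile is `v = (v₁, v₂) ∈ [0, 1]²`. -/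
abbrev Value : Type := unitInterval

/-- A direct mechanism for one good and two bidders: allocation probabilities `q₁, q₂` and
payments `t₁, t₂`, as functions of the profile of reported values. -/
structure Mechanism where
  q₁ : Value × Value → ℝ
  q₂ : Value × Value → ℝ
  t₁ : Value × Value → ℝ
  t₂ : Value × Value → ℝ

namespace Mechanism

/-- The allocation is a (sub)probability vector at each profile, and all rules are Borel. -/
structure IsFeasible (M : Mechanism) : Prop where
  measurable_q₁ : Measurable M.q₁
  measurable_q₂ : Measurable M.q₂
  measurable_t₁ : Measurable M.t₁
  measurable_t₂ : Measurable M.t₂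
  q₁_nonneg : ∀ v, 0 ≤ M.q₁ v
  q₂_nonneg : ∀ v, 0 ≤ M.q₂ v
  q_sum_le_one : ∀ v, M.q₁ v + M.q₂ v ≤ 1

/-- Ex-post individual rationality. -/
structure IsEPIR (M : Mechanism) : Prop where
  bidder₁ : ∀ v₁ v₂ : Value, 0 ≤ (v₁ : ℝ) * M.q₁ (v₁, v₂) - M.t₁ (v₁, v₂)
  bidder₂ : ∀ v₁ v₂ : Value, 0 ≤ (v₂ : ℝ) * M.q₂ (v₁, v₂) - M.t₂ (v₁, v₂)

/-- Dominant strategy incentive compatibility: truth-telling is optimal for each bidder, whatever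
the report of the other one. -/
structure IsDSIC (M : Mechanism) : Prop where
  bidder₁ : ∀ v₁ v₂ v₁' : Value,
    (v₁ : ℝ) * M.q₁ (v₁', v₂) - M.t₁ (v₁', v₂) ≤ (v₁ : ℝ) * M.q₁ (v₁, v₂) - M.t₁ (v₁, v₂)
  bidder₂ : ∀ v₁ v₂ v₂' : Value,
    (v₂ : ℝ) * M.q₂ (v₁, v₂') - M.t₂ (v₁, v₂') ≤ (v₂ : ℝ) * M.q₂ (v₁, v₂) - M.t₂ (v₁, v₂)

/-- The auctioneer's ex-post revenue at a profile of (truthfully reported) values. -/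
def totalPayment (M : Mechanism) (v : Value × Value) : ℝ := M.t₁ v + M.t₂ v

/-- Expected revenue under the joint distribution `π`. Ex-post individual rationality bounds the
payments above by `1`, but they need not be bounded below, so the expectation is taken in
`[-∞, ∞]`: expectation of the positive part minus expectation of the negative part. -/
def revenue (M : Mechanism) (π : Measure (Value × Value)) : EReal :=
  ((∫⁻ v, ENNReal.ofReal (M.totalPayment v) ∂π : ENNReal) : EReal) -
    ((∫⁻ v, ENNReal.ofReal (-M.totalPayment v) ∂π : ENNReal) : EReal)

end Mechanism

/-- The class of DSIC and EPIR direct mechanisms for two bidders. -/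
def dsicEpirMechanisms : Set Mechanism :=
  {M | M.IsFeasible ∧ M.IsDSIC ∧ M.IsEPIR}

/-- The joint distributions on `[0, 1]²` both of whose marginals are `F`. -/
def jointDistributions (F : Measure Value) : Set (Measure (Value × Value)) :=
  {π | π.map Prod.fst = F ∧ π.map Prod.snd = F}

/-- Worst-case expected revenue over the joint distributions consistent with the marginal `F`. -/
def worstCaseRevenue (F : Measure Value) (M : Mechanism) : EReal :=
  ⨅ π ∈ jointDistributions F, M.revenue π

/-- `M` is a maxmin auction among DSIC and EPIR mechanisms, given the marginal `F`. -/
def IsMaxminAuction (F : Measure Value) (M : Mechanism) : Prop :=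
  M ∈ dsicEpirMechanisms ∧
    ∀ M' ∈ dsicEpirMechanisms, worstCaseRevenue F M' ≤ worstCaseRevenue F M

/-- The second price auction with a reserve uniformly distributed on `[0, 1]`: the high bidder, with
bid `v`, wins with probability `v`, ties are broken evenly, and the expected payments are those
of the second price auction. -/
def uniformReserveSPA : Mechanism where
  q₁ v := if v.2 < v.1 then (v.1 : ℝ) else if v.1 < v.2 then 0 else (v.1 : ℝ) / 2
  q₂ v := if v.1 < v.2 then (v.2 : ℝ) else if v.2 < v.1 then 0 else (v.2 : ℝ) / 2
  t₁ v := if v.2 < v.1 then ((v.1 : ℝ) ^ 2 + (v.2 : ℝ) ^ 2) / 2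
    else if v.1 < v.2 then 0 else (v.1 : ℝ) ^ 2 / 2
  t₂ v := if v.1 < v.2 then ((v.1 : ℝ) ^ 2 + (v.2 : ℝ) ^ 2) / 2
    else if v.2 < v.1 then 0 else (v.2 : ℝ) ^ 2 / 2

/-- `f` is a density of `F` on the open interval `(0, 1)`; `F` may have atoms at `0` and `1`. -/
structure IsInteriorDensity (F : Measure Value) (f : Value → ℝ) : Prop where
  measurable : Measurable f
  nonneg : ∀ x, 0 ≤ f x
  restrict_eq : F.restrict (Ioo 0 1) =
    (volume.restrict (Ioo 0 1)).withDensity (fun x => ENNReal.ofReal (f x))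

/-- The robust-version regularity conditions on a marginal `F` with density `f` on `(0, 1)`:
`x² f(x)` is non-decreasing on `(0, 1)`, and `F` has mass at least `∫ x² f(x) dx` at `1`. -/
structure RobustRegular (F : Measure Value) (f : Value → ℝ) : Prop where
  monotone : MonotoneOn (fun x : Value => (x : ℝ) ^ 2 * f x) (Ioo 0 1)
  mass : ∫⁻ x in Ioo (0 : Value) 1, ENNReal.ofReal ((x : ℝ) ^ 2 * f x) ≤ F {1}

/-- The robust-version regularity conditions hold almost surely: `F` has a density on `(0, 1)`, and
the conditions hold for a suitable version of it. (A density is only determined up to a Lebesgue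
null set; each of its versions then satisfies the conditions off such a set.) -/
def RobustRegularAlmostSurely (F : Measure Value) : Prop :=
  ∃ f : Value → ℝ, IsInteriorDensity F f ∧ RobustRegular F f

end RobustAuction

end

/-! The uniform-reserve auction collects `v₁² / 2 + v₂² / 2`, which is additive across bidders, so
its expected revenue is `∫ x² dF` under every coupling. If another admissible mechanism collects at
least `φ v₁ + φ v₂` at every profile, it guarantees `2 ∫ φ dF`; optimality therefore forces `2 ∫ φ
dF ≤ ∫ x² dF` (`two_mul_integral_le`). Each such deviation is thus a linear inequality on `F`, and
two families suffice.

Shrinking the support of the reserve to `[0, r]` gains about `(1 - r) x²` (over both bidders'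
halves) at values below `1` and loses `1 - r` at the value `1`. Dividing by `1 - r` and letting `r ↑
1` gives the mass condition (`setIntegral_sq_le`).

For `s < b`, selling to the low bidder with small probability changes the additive revenue by a
multiple of `x² (s + b - 2x)` on `(s, b)`. Hence the measure `μ = x² dF` has its barycentre in the
right half of every interval (`integral_revenueShift_nonpos`). By Fubini this is the trapezoidal
inequality for the distribution function of `μ`, which for a monotone function implies continuity
and then convexity. A convex distribution function has its right derivative `D` as a non-decreasing
density, and `f = D / x²` is the density of `F`. -/

namespace RobustAuction

/-! ### Incentive compatibility as a subgradient condition -/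

/-- `Q` is a selection of subgradients of `U` on `S`. -/
def IsSubgradientOn (U Q : ℝ → ℝ) (S : Set ℝ) : Prop :=
  ∀ v ∈ S, ∀ w ∈ S, U w + (v - w) * Q w ≤ U v

/-- The single value `Q m` is a subgradient from both sides, so `Q` is ordered across `m`; chaining
the two inequalities through `m` then needs no separate condition on the slopes there. -/
theorem IsSubgradientOn.glue {U Q : ℝ → ℝ} {a m b : ℝ} (h₁ : IsSubgradientOn U Q (Icc a m))
    (h₂ : IsSubgradientOn U Q (Icc m b)) (ham : a ≤ m) (hmb : m ≤ b) :
    IsSubgradientOn U Q (Icc a b) := by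
  intro v hv w hw
  have m₁ : m ∈ Icc a m := ⟨ham, le_rfl⟩
  have m₂ : m ∈ Icc m b := ⟨le_rfl, hmb⟩
  rcases le_total v m with hvm | hvm <;> rcases le_total w m with hwm | hwm
  · exact h₁ v ⟨hv.1, hvm⟩ w ⟨hw.1, hwm⟩
  · have e₁ := h₁ v ⟨hv.1, hvm⟩ m m₁
    have e₂ := h₂ m m₂ w ⟨hwm, hw.2⟩
    have e₃ := h₂ w ⟨hwm, hw.2⟩ m m₂
    rcases hwm.eq_or_lt with rfl | hwm
    · exact e₁
    have : Q m ≤ Q w := by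
      by_contra! hlt
      nlinarith
    nlinarith
  · have e₁ := h₂ v ⟨hvm, hv.2⟩ m m₂
    have e₂ := h₁ m m₁ w ⟨hw.1, hwm⟩
    have e₃ := h₁ w ⟨hw.1, hwm⟩ m m₁
    rcases hwm.eq_or_lt with rfl | hwm
    · exact e₁
    have : Q w ≤ Q m := by
      by_contra! hlt
      nlinarith
    nlinarith
  · exact h₂ v ⟨hvm, hv.2⟩ w ⟨hwm, hw.2⟩

/-- Only the sign of the change matters when `Q` is changed at the end points of an interval. -/
theorem IsSubgradientOn.of_Ioo {U Q E q : ℝ → ℝ} {a b : ℝ}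
    (h : IsSubgradientOn E q (Icc a b)) (hU : ∀ v ∈ Icc a b, U v = E v)
    (hQ : ∀ v ∈ Ioo a b, Q v = q v) (ha : a < b → Q a ≤ q a) (hb : a < b → q b ≤ Q b) :
    IsSubgradientOn U Q (Icc a b) := by
  intro v hv w hw
  rw [hU v hv, hU w hw]
  have key := h v hv w hw
  rcases (hv.1.trans hv.2).eq_or_lt with rfl | hab
  · simp [le_antisymm hv.2 hv.1, le_antisymm hw.2 hw.1]
  rcases hw.1.eq_or_lt with rfl | haw
  · nlinarith [mul_le_mul_of_nonneg_left (ha hab) (sub_nonneg.2 hv.1)]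
  rcases hw.2.eq_or_lt with rfl | hwb
  · nlinarith [mul_le_mul_of_nonneg_left (hb hab) (sub_nonneg.2 hv.2)]
  · rw [hQ w ⟨haw, hwb⟩]; exact key

/-- The mechanism that treats the bidders alike: a bidder with value `v` facing a rival with value
`c` wins with probability `Q v c` and pays `T v c`. -/
noncomputable def symmetricMechanism (Q T : ℝ → ℝ → ℝ) : Mechanism where
  q₁ v := Q v.1 v.2
  q₂ v := Q v.2 v.1
  t₁ v := T v.1 v.2
  t₂ v := T v.2 v.1

/-- With `U` the truthful payoff, the subgradient inequality is exactly DSIC. Comparison with the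
report `0` then yields EPIR, since that report wins with nonnegative probability and pays nothing
positive. -/
theorem symmetricMechanism_mem {Q T : ℝ → ℝ → ℝ}
    (hQ : Measurable (Function.uncurry Q)) (hT : Measurable (Function.uncurry T))
    (hQ0 : ∀ v ∈ Icc (0 : ℝ) 1, ∀ c ∈ Icc (0 : ℝ) 1, 0 ≤ Q v c)
    (hQ1 : ∀ v ∈ Icc (0 : ℝ) 1, ∀ c ∈ Icc (0 : ℝ) 1, c ≤ v → Q v c + Q c v ≤ 1)
    (hT0 : ∀ c ∈ Icc (0 : ℝ) 1, T 0 c ≤ 0)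
    (hIC : ∀ c ∈ Icc (0 : ℝ) 1,
      IsSubgradientOn (fun v => v * Q v c - T v c) (fun v => Q v c) (Icc 0 1)) :
    symmetricMechanism Q T ∈ dsicEpirMechanisms := by
  have m₁ : Measurable fun v : Value × Value => ((v.1 : ℝ), (v.2 : ℝ)) := by fun_prop
  have m₂ : Measurable fun v : Value × Value => ((v.2 : ℝ), (v.1 : ℝ)) := by fun_prop
  have ic : ∀ v c w : Value, (v : ℝ) * Q w c - T w c ≤ v * Q v c - T v c := by
    intro v c w
    have := hIC c c.2 v v.2 w w.2
    simp only at this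
    linarith
  have ir : ∀ v c : Value, 0 ≤ (v : ℝ) * Q v c - T v c := by
    intro v c
    have h₁ := ic v c 0
    have h₂ := hT0 c c.2
    have h₃ := mul_nonneg v.2.1 (hQ0 0 ⟨le_rfl, zero_le_one⟩ c c.2)
    simp only [Set.Icc.coe_zero] at h₁
    linarith
  refine ⟨⟨hQ.comp m₁, hQ.comp m₂, hT.comp m₁, hT.comp m₂, fun v => hQ0 _ v.1.2 _ v.2.2,
    fun v => hQ0 _ v.2.2 _ v.1.2, fun v => ?_⟩, ⟨fun v c w => ic v c w, fun v c w => ic c v w⟩,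
    ⟨fun v c => ir v c, fun v c => ir c v⟩⟩
  rcases le_total v.2 v.1 with h | h
  · exact hQ1 _ v.1.2 _ v.2.2 h
  · have := hQ1 _ v.2.2 _ v.1.2 h
    simp only [symmetricMechanism]
    linarith

/-! ### The second price auction with a reserve that is uniform on `[0, r]` -/

/-- An antiderivative of the distribution function of the uniform reserve on `[0, r]`. -/
noncomputable def reserveIntegral (r v : ℝ) : ℝ := if v ≤ r then v ^ 2 / (2 * r) else v - r / 2

/-- `min 1 (v / r)` is the probability that the reserve is at most `v`. The payment is chosen so
that the payoff is `0` below the rival's value `c` and `reserveIntegral r v - reserveIntegral r c`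
above it. -/
noncomputable def shortReserveAllocation (r v c : ℝ) : ℝ :=
  if v < c then 0 else if c < v then min 1 (v / r) else min 1 (v / r) / 2

noncomputable def shortReservePayment (r v c : ℝ) : ℝ :=
  if v < c then 0 else if c < v then v * min 1 (v / r) - reserveIntegral r v + reserveIntegral r c
    else v * min 1 (v / r) / 2

theorem measurable_reserveIntegral (r : ℝ) : Measurable (reserveIntegral r) :=
  Measurable.ite measurableSet_Iic (by fun_prop) (by fun_prop)

theorem isSubgradientOn_reserveIntegral {r : ℝ} (hr : 0 < r) :
    IsSubgradientOn (reserveIntegral r) (fun v => min 1 (v / r)) univ := by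
  intro v _ w _
  simp only [reserveIntegral]
  have e₁ : w ≤ r → min 1 (w / r) = w / r := fun h => min_eq_right ((div_le_one hr).2 h)
  have e₂ : ¬ w ≤ r → min 1 (w / r) = 1 :=
    fun h => min_eq_left ((one_le_div hr).2 (not_le.1 h).le)
  split_ifs with h₁ h₂ h₂
  · rw [e₁ h₁]
    field_simp
    nlinarith [sq_nonneg (v - w)]
  · rw [e₁ h₁]
    field_simp
    nlinarith [mul_nonneg (sub_nonneg.2 h₁) (sub_nonneg.2 (not_le.1 h₂).le), sq_nonneg (r - w)]
  · rw [e₂ h₁]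
    field_simp
    nlinarith [sq_nonneg (v - r)]
  · rw [e₂ h₁]; linarith

theorem shortReserve_mem {r : ℝ} (hr : 0 < r) :
    symmetricMechanism (shortReserveAllocation r) (shortReservePayment r) ∈ dsicEpirMechanisms := by
  have mfst : Measurable fun p : ℝ × ℝ => p.1 := measurable_fst
  have msnd : Measurable fun p : ℝ × ℝ => p.2 := measurable_snd
  have mE := measurable_reserveIntegral r
  have hmin : ∀ v : ℝ, 0 ≤ v → 0 ≤ min 1 (v / r) := fun v hv => le_min zero_le_one (by positivity)
  have hmin1 : ∀ v : ℝ, min 1 (v / r) ≤ 1 := fun v => min_le_left _ _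
  refine symmetricMechanism_mem ?_ ?_ ?_ ?_ ?_ ?_
  · exact Measurable.ite (measurableSet_lt mfst msnd) (by fun_prop)
      (Measurable.ite (measurableSet_lt msnd mfst) (by fun_prop) (by fun_prop))
  · refine Measurable.ite (measurableSet_lt mfst msnd) (by fun_prop)
      (Measurable.ite (measurableSet_lt msnd mfst) ?_ (by fun_prop))
    exact ((mfst.mul (by fun_prop)).sub (mE.comp mfst)).add (mE.comp msnd)
  · intro v hv c hc
    have := hmin v hv.1
    unfold shortReserveAllocation
    split_ifs <;> linarith
  · intro v hv c hc hcv
    have := hmin1 v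
    have := hmin1 c
    rcases hcv.eq_or_lt with rfl | h
    · simp only [shortReserveAllocation, lt_irrefl, if_false]
      linarith
    · simp only [shortReserveAllocation, h, h.not_gt, if_true, if_false]
      linarith
  · intro c hc
    simp only [shortReservePayment]
    rcases hc.1.eq_or_lt with rfl | h
    · simp
    · simp [h]
  · intro c hc
    have hE := isSubgradientOn_reserveIntegral hr
    have hc' := hmin c hc.1
    refine IsSubgradientOn.glue (m := c) ?_ ?_ hc.1 hc.2
    · intro v hv w hw
      have hw' := hmin w hw.1
      have z : ∀ x ∈ Icc 0 c,
          x * shortReserveAllocation r x c - shortReservePayment r x c = 0 := by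
        intro x hx
        rcases hx.2.eq_or_lt with rfl | h
        · simp only [shortReserveAllocation, shortReservePayment, lt_irrefl, if_false]; ring
        · simp [shortReserveAllocation, shortReservePayment, h]
      simp only
      rw [z v hv, z w hw]
      rcases hw.2.eq_or_lt with rfl | h
      · simp only [shortReserveAllocation, lt_irrefl, if_false]
        nlinarith [mul_nonneg (sub_nonneg.2 hv.2) hc']
      · simp [shortReserveAllocation, h]
    · intro v hv w hw
      have z : ∀ x ∈ Icc c 1, x * shortReserveAllocation r x c - shortReservePayment r x c =
          reserveIntegral r x - reserveIntegral r c := by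
        intro x hx
        rcases hx.1.eq_or_lt with rfl | h
        · simp only [shortReserveAllocation, shortReservePayment, lt_irrefl, if_false]; ring
        · simp only [shortReserveAllocation, shortReservePayment, h, h.not_gt, if_true, if_false]
          ring
      simp only
      rw [z v hv, z w hw]
      have key := hE v trivial w trivial
      simp only at key
      rcases hw.1.eq_or_lt with rfl | h
      · simp only [shortReserveAllocation, lt_irrefl, if_false]
        nlinarith [mul_nonneg (sub_nonneg.2 hv.1) hc']
      · simp only [shortReserveAllocation, h, h.not_gt, if_true, if_false]
        linarith

/-- With `E = reserveIntegral r`, a high value `x` and a low value `y` yield `(x E'(x) - E(x)) +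
E(y)`. The first term equals the truncated square of `x`, and `E(y)` is at least that of `y`. -/
theorem shortReserve_totalPayment {r : ℝ} (hr : 0 < r) (v : Value × Value) :
    min ((v.1 : ℝ) ^ 2 / (2 * r)) (r / 2) + min ((v.2 : ℝ) ^ 2 / (2 * r)) (r / 2) ≤
      (symmetricMechanism (shortReserveAllocation r) (shortReservePayment r)).totalPayment v := by
  have key : ∀ x y : ℝ, 0 ≤ y → y ≤ x →
      min (x ^ 2 / (2 * r)) (r / 2) + min (y ^ 2 / (2 * r)) (r / 2) ≤
        x * min 1 (x / r) - reserveIntegral r x + reserveIntegral r y := by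
    intro x y hy hyx
    have hx := hy.trans hyx
    rcases le_or_gt x r with h | h
    · rw [min_eq_right ((div_le_one hr).2 h)]
      simp only [reserveIntegral, h, hyx.trans h, if_true]
      have e : x * (x / r) = x ^ 2 / (2 * r) + x ^ 2 / (2 * r) := by field_simp; ring
      rw [e]
      linarith [min_le_left (x ^ 2 / (2 * r)) (r / 2), min_le_left (y ^ 2 / (2 * r)) (r / 2)]
    · rw [min_eq_left ((one_le_div hr).2 h.le)]
      simp only [reserveIntegral, h.not_ge, if_false]
      split_ifs with h'
      · linarith [min_le_right (x ^ 2 / (2 * r)) (r / 2), min_le_left (y ^ 2 / (2 * r)) (r / 2)]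
      · linarith [min_le_right (x ^ 2 / (2 * r)) (r / 2), min_le_right (y ^ 2 / (2 * r)) (r / 2)]
  simp only [Mechanism.totalPayment, symmetricMechanism, shortReservePayment]
  rcases lt_trichotomy (v.1 : ℝ) v.2 with h | h | h
  · have := key v.2 v.1 v.1.2.1 h.le
    simp only [h, h.not_gt, if_true, if_false]
    linarith
  · have := key v.1 v.2 v.2.2.1 h.ge
    rw [h] at this
    simp only [h, lt_irrefl, if_false]
    linarith
  · have := key v.1 v.2 v.2.2.1 h.le
    simp only [h, h.not_gt, if_true, if_false]
    linarith

/-! ### Selling to the low bidder with small probability -/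

/-- The change (up to a factor) that a value contributes to the revenue. -/
noncomputable def revenueShift (s b x : ℝ) : ℝ := if s < x ∧ x < b then x ^ 2 * (s + b - 2 * x) else 0

/-- What the low bidder `c` pays (up to a factor) against a rival `v`. -/
noncomputable def lowBidderFee (s b c v : ℝ) : ℝ := if s < c ∧ v < b then v ^ 2 * s else 0

/-- Against a high value `c < b`, the low bidder is offered the winning probability `c² / 6` at the
posted price `s` per unit. The high bidder's allocation solves `v U' - U = T` for the payment `T`
below, with constants making `U` continuous. At a tie in `(s, b)` the allocation is the mean of the
two one-sided slopes of `U`. The factor `1 / 6` is small enough to keep `U` convex and the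
probabilities feasible. -/
noncomputable def lowBidderAllocation (s b v c : ℝ) : ℝ :=
  if v < c then (if s < v ∧ c < b then c ^ 2 / 6 else 0)
  else if c < v then
    v + (if s < v ∧ v < b then
      (if s < c then 2 * v * b - 3 * v ^ 2 else 2 * v * b - 3 * v ^ 2 + 2 * v * s - s * b) / 6
      else 0)
  else c / 2 + (if s < c ∧ c < b then c * (b - c) / 6 else 0)

/-- The high bidder's payment is reduced by exactly the low bidder's fee, so the non-additive term
cancels from the total. -/
noncomputable def lowBidderPayment (s b v c : ℝ) : ℝ :=
  if v < c then lowBidderFee s b v c / 6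
  else if c < v then
    (v ^ 2 + c ^ 2) / 2 + (revenueShift s b v + revenueShift s b c - lowBidderFee s b c v) / 6
  else c ^ 2 / 2 + revenueShift s b c / 6

theorem lowBidder_totalPayment (s b : ℝ) (v : Value × Value) :
    (symmetricMechanism (lowBidderAllocation s b) (lowBidderPayment s b)).totalPayment v =
      ((v.1 : ℝ) ^ 2 / 2 + revenueShift s b v.1 / 6) +
        ((v.2 : ℝ) ^ 2 / 2 + revenueShift s b v.2 / 6) := by
  simp only [Mechanism.totalPayment, symmetricMechanism, lowBidderPayment]
  rcases lt_trichotomy (v.1 : ℝ) v.2 with h | h | h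
  · simp only [h, h.not_gt, if_true, if_false]; ring
  · simp only [h, lt_irrefl, if_false]
  · simp only [h, h.not_gt, if_true, if_false]; ring

theorem measurable_revenueShift (s b : ℝ) : Measurable (revenueShift s b) :=
  Measurable.ite (measurableSet_Ioi.inter measurableSet_Iio) (by fun_prop) (by fun_prop)

theorem isSubgradientOn_const (k : ℝ) (S : Set ℝ) :
    IsSubgradientOn (fun _ => k) (fun _ => 0) S := by
  intro v _ w _
  simp

theorem isSubgradientOn_linear (m k : ℝ) (S : Set ℝ) :
    IsSubgradientOn (fun v => m * v + k) (fun _ => m) S := by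
  intro v _ w _
  simp only
  linarith

/-- The first-order Taylor remainder of the cubic at `w` is `(v - w)² (p₂ + p₃ (v + 2w))`. -/
theorem isSubgradientOn_cubic (p₀ p₁ p₂ p₃ : ℝ) {a b : ℝ}
    (h : ∀ v ∈ Icc a b, ∀ w ∈ Icc a b, 0 ≤ p₂ + p₃ * (v + 2 * w)) :
    IsSubgradientOn (fun v => p₃ * v ^ 3 + p₂ * v ^ 2 + p₁ * v + p₀)
      (fun v => 3 * p₃ * v ^ 2 + 2 * p₂ * v + p₁) (Icc a b) := by
  intro v hv w hw
  have := mul_nonneg (sq_nonneg (v - w)) (h v hv w hw)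
  simp only
  nlinarith

/-- For a fixed rival value `c`, the payoff is continuous and polynomial between the breakpoints
among `s`, `c`, `b`. Each piece is convex (the cubic ones because `b ≤ 1`), and at each breakpoint
the allocation lies between the one-sided slopes, so the pieces glue. -/
theorem lowBidder_incentives {s b : ℝ} (hs : 0 ≤ s) (hsb : s < b) (hb : b ≤ 1) {c : ℝ}
    (hc : c ∈ Icc (0 : ℝ) 1) :
    IsSubgradientOn (fun v => v * lowBidderAllocation s b v c - lowBidderPayment s b v c)
      (fun v => lowBidderAllocation s b v c) (Icc 0 1) := by
  obtain ⟨hc0, hc1⟩ := hc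
  rcases le_or_gt b c with hbc | hcb
  · refine IsSubgradientOn.glue (m := c) ?_ ?_ hc0 hc1
    · refine (isSubgradientOn_const 0 (Icc 0 c)).of_Ioo ?_ ?_ ?_ ?_ <;>
        grind [lowBidderAllocation, lowBidderPayment, lowBidderFee, revenueShift]
    · refine (isSubgradientOn_cubic (-c ^ 2 / 2) 0 (1 / 2) 0 (a := c) (b := 1) ?_).of_Ioo ?_ ?_ ?_ ?_
      · intros; norm_num
      all_goals grind [lowBidderAllocation, lowBidderPayment, lowBidderFee, revenueShift]
  rcases le_or_gt c s with hcs | hsc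
  · refine IsSubgradientOn.glue (m := c) ?_ (IsSubgradientOn.glue (m := s) ?_
      (IsSubgradientOn.glue (m := b) ?_ ?_ hsb.le hb) hcs (hsb.le.trans hb)) hc0 hc1
    · refine (isSubgradientOn_const 0 (Icc 0 c)).of_Ioo ?_ ?_ ?_ ?_ <;>
        grind [lowBidderAllocation, lowBidderPayment, lowBidderFee, revenueShift]
    · refine (isSubgradientOn_cubic (-c ^ 2 / 2) 0 (1 / 2) 0 (a := c) (b := s) ?_).of_Ioo ?_ ?_ ?_ ?_
      · intros; norm_num
      all_goals grind [lowBidderAllocation, lowBidderPayment, lowBidderFee, revenueShift]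
    · refine (isSubgradientOn_cubic (-c ^ 2 / 2) (-(s * b) / 6) (1 / 2 + (b + s) / 6) (-1 / 6)
        (a := s) (b := b) ?_).of_Ioo ?_ ?_ ?_ ?_
      · intro v hv w hw; linarith [hv.2, hw.2, hv.1]
      · grind [lowBidderAllocation, lowBidderPayment, lowBidderFee, revenueShift]
      · grind [lowBidderAllocation, lowBidderPayment, lowBidderFee, revenueShift]
      · have : lowBidderAllocation s b s c ≤ s := by grind [lowBidderAllocation]
        intro
        nlinarith [mul_nonneg hs (sub_nonneg.2 hsb.le)]
      · have : lowBidderAllocation s b b c = b := by grind [lowBidderAllocation]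
        intro
        nlinarith [mul_nonneg (hs.trans hsb.le) (sub_nonneg.2 hsb.le)]
    · refine (isSubgradientOn_cubic (-c ^ 2 / 2) 0 (1 / 2) 0 (a := b) (b := 1) ?_).of_Ioo ?_ ?_ ?_ ?_
      · intros; norm_num
      all_goals grind [lowBidderAllocation, lowBidderPayment, lowBidderFee, revenueShift]
  · have hT : lowBidderAllocation s b c c = c / 2 + c * (b - c) / 6 := by
      grind [lowBidderAllocation]
    refine IsSubgradientOn.glue (m := s) ?_ (IsSubgradientOn.glue (m := c) ?_
      (IsSubgradientOn.glue (m := b) ?_ ?_ hcb.le hb) hsc.le (hcb.le.trans hb)) hs (hsb.le.trans hb)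
    · refine (isSubgradientOn_const 0 (Icc 0 s)).of_Ioo ?_ ?_ ?_ ?_ <;>
        grind [lowBidderAllocation, lowBidderPayment, lowBidderFee, revenueShift]
    · refine (isSubgradientOn_linear (c ^ 2 / 6) (-c ^ 2 * s / 6) (Icc s c)).of_Ioo ?_ ?_ ?_ ?_
      · grind [lowBidderAllocation, lowBidderPayment, lowBidderFee, revenueShift]
      · grind [lowBidderAllocation, lowBidderPayment, lowBidderFee, revenueShift]
      · have : lowBidderAllocation s b s c = 0 := by grind [lowBidderAllocation]
        rw [this]
        intro
        positivity
      · rw [hT]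
        intro
        nlinarith
    · refine (isSubgradientOn_cubic (-c ^ 2 / 2 - c ^ 2 * (b + s - 2 * c) / 6) 0 (1 / 2 + b / 6)
        (-1 / 6) (a := c) (b := b) ?_).of_Ioo ?_ ?_ ?_ ?_
      · intro v hv w hw; linarith [hv.2, hw.2, hv.1]
      · intro v hv
        rcases hv.1.eq_or_lt with rfl | h
        · simp only [hT]
          simp only [lowBidderPayment, revenueShift, lt_irrefl, hsc, hcb, and_self, if_true, if_false]
          ring
        · have e := hsc.trans h
          simp only [lowBidderAllocation, lowBidderPayment, lowBidderFee, revenueShift, h,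
            h.not_gt, hsc, hcb, e, true_and, if_true, if_false]
          split_ifs with h'
          · ring
          · obtain rfl : v = b := le_antisymm hv.2 (not_lt.1 h')
            ring
      · grind [lowBidderAllocation, lowBidderPayment, lowBidderFee, revenueShift]
      · rw [hT]
        intro
        nlinarith
      · have : lowBidderAllocation s b b c = b := by grind [lowBidderAllocation]
        rw [this]
        intro
        nlinarith
    · refine (isSubgradientOn_cubic (-c ^ 2 / 2 - c ^ 2 * (b + s - 2 * c) / 6) 0 (1 / 2) 0
        (a := b) (b := 1) ?_).of_Ioo ?_ ?_ ?_ ?_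
      · intros; norm_num
      all_goals grind [lowBidderAllocation, lowBidderPayment, lowBidderFee, revenueShift]

theorem lowBidder_mem {s b : ℝ} (hs : 0 ≤ s) (hsb : s < b) (hb : b ≤ 1) :
    symmetricMechanism (lowBidderAllocation s b) (lowBidderPayment s b) ∈ dsicEpirMechanisms := by
  have mfst : Measurable fun p : ℝ × ℝ => p.1 := measurable_fst
  have msnd : Measurable fun p : ℝ × ℝ => p.2 := measurable_snd
  have mlt := measurableSet_lt mfst msnd
  have mgt := measurableSet_lt msnd mfst
  have s₁ := measurableSet_lt (measurable_const (a := s)) mfst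
  have s₂ := measurableSet_lt (measurable_const (a := s)) msnd
  have b₁ := measurableSet_lt mfst (measurable_const (a := b))
  have b₂ := measurableSet_lt msnd (measurable_const (a := b))
  have mg := measurable_revenueShift s b
  refine symmetricMechanism_mem ?_ ?_ ?_ ?_ ?_ fun c hc => lowBidder_incentives hs hsb hb hc
  · refine Measurable.ite mlt (Measurable.ite (s₁.inter b₂) (by fun_prop) (by fun_prop))
      (Measurable.ite mgt (mfst.add (Measurable.ite (s₁.inter b₁) (Measurable.div_const
        (Measurable.ite s₂ (by fun_prop) (by fun_prop)) _) (by fun_prop))) (Measurable.add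
          (by fun_prop) (Measurable.ite (s₂.inter b₂) (by fun_prop) (by fun_prop))))
  · refine Measurable.ite mlt (Measurable.div_const
      (Measurable.ite (s₁.inter b₂) (by fun_prop) (by fun_prop)) _)
      (Measurable.ite mgt (Measurable.add (by fun_prop) (Measurable.div_const (Measurable.sub
        ((mg.comp mfst).add (mg.comp msnd))
        (Measurable.ite (s₂.inter b₁) (by fun_prop) (by fun_prop))) _)) (Measurable.add
          (by fun_prop) (Measurable.div_const (mg.comp msnd) _)))
  · intro v ⟨hv0, hv1⟩ c ⟨hc0, hc1⟩
    unfold lowBidderAllocation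
    split_ifs with h₁ h₂ h₃ h₄ h₅
    · positivity
    · exact le_rfl
    · nlinarith
    · nlinarith [mul_nonneg hs (sub_nonneg.2 h₄.1.le), mul_nonneg hv0 (sub_nonneg.2 h₄.2.le), mul_nonneg (sub_nonneg.2 h₄.1.le) (sub_nonneg.2 h₄.2.le)]
    · linarith
    · nlinarith
    · linarith
  · intro v ⟨hv0, hv1⟩ c ⟨hc0, hc1⟩ hcv
    rcases hcv.eq_or_lt with rfl | h
    · simp only [lowBidderAllocation, lt_irrefl, if_false]
      split_ifs with h'
      · nlinarith
      · linarith
    · simp only [lowBidderAllocation, h, h.not_gt, if_true, if_false]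
      split_ifs with h₁ h₂ h₃ h₃ h₃
      · nlinarith [h₁.2]
      · exact absurd ⟨h₂, h₁.2⟩ h₃
      · exact absurd h₃.1 h₂
      · nlinarith [mul_nonneg hv0 (sub_nonneg.2 h₁.1.le), mul_nonneg hs (sub_nonneg.2 h₁.2.le)]
      · exact absurd ⟨h₃.1.trans h, h₃.2⟩ h₁
      · linarith
  · intro c hc
    simp only [lowBidderPayment, lowBidderFee, revenueShift]
    rcases hc.1.eq_or_lt with rfl | h
    · simp [hs.not_gt]
    · simp [h, hs.not_gt]

/-! ### From the trapezoidal inequality to convexity -/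

open Filter Topology

/-- The trapezoidal rule on every interval overestimates the integral of `Y`: the right hand
Hermite–Hadamard inequality. -/
def HermiteHadamardOn (Y : ℝ → ℝ) (α β : ℝ) : Prop :=
  ∀ s b, α < s → s < b → b < β → 2 * ∫ u in s..b, Y u ≤ (b - s) * (Y s + Y b)

/-- A jump at `x` violates the inequality on a short interval with more of its length to the right
of `x`, where the integral already sees the upper value. -/
theorem HermiteHadamardOn.continuousOn {Y : ℝ → ℝ} {α β : ℝ} (h : HermiteHadamardOn Y α β)
    (hY : Monotone Y) : ContinuousOn Y (Ioo α β) := by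
  intro x hx
  refine ContinuousAt.continuousWithinAt (hY.continuousAt_iff_leftLim_eq_rightLim.2
    (le_antisymm (hY.leftLim_le_rightLim le_rfl) ?_))
  set R := Function.rightLim Y x
  have key : ∀ᶠ y in 𝓝[>] x, 4 * R - Function.leftLim Y x ≤ 3 * Y y := by
    have e₁ : ∀ᶠ y in 𝓝[>] x, x < y := self_mem_nhdsWithin
    have e₂ : ∀ᶠ y in 𝓝[>] x, y < β := nhdsWithin_le_nhds (Iio_mem_nhds hx.2)
    have e₃ : ∀ᶠ y in 𝓝[>] x, y < x + 2 * (x - α) :=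
      nhdsWithin_le_nhds (Iio_mem_nhds (by linarith [hx.1]))
    filter_upwards [e₁, e₂, e₃] with y h₁ h₂ h₃
    -- The window is `[x - δ, x + 2δ]`. A symmetric one would be useless: in the limit the
    -- inequality becomes an equality at a jump. The ratio `1 : 2` gives `4R - L ≤ 3R` in the limit,
    -- where `L` is the left limit.
    set δ := (y - x) / 2 with hδ
    have hδ0 : 0 < δ := by linarith
    have hy : y = x + 2 * δ := by linarith
    have hh := h (x - δ) y (by linarith) (by linarith) h₂
    have i : ∀ p q, IntervalIntegrable Y volume p q := fun p q => hY.intervalIntegrable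
    rw [← intervalIntegral.integral_add_adjacent_intervals (i (x - δ) x) (i x y)] at hh
    have l₁ : ∫ u in (x - δ)..x, Y (x - δ) ≤ ∫ u in (x - δ)..x, Y u :=
      intervalIntegral.integral_mono_on (by linarith) (by simp) (i _ _) fun u hu => hY hu.1
    have l₂ : ∫ u in x..y, R ≤ ∫ u in x..y, Y u :=
      intervalIntegral.integral_mono_on_of_le_Ioo h₁.le (by simp) (i _ _)
        fun u hu => hY.rightLim_le hu.1
    simp only [intervalIntegral.integral_const, smul_eq_mul] at l₁ l₂
    have l₃ : Y (x - δ) ≤ Function.leftLim Y x := hY.le_leftLim (by linarith)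
    have : δ * (4 * R - Y (x - δ)) ≤ δ * (3 * Y y) := by
      rw [hy] at hh l₂ ⊢
      nlinarith
    linarith [le_of_mul_le_mul_left this hδ0]
  have t : Tendsto (fun y => 3 * Y y) (𝓝[>] x) (𝓝 (3 * R)) :=
    (hY.tendsto_rightLim x).const_mul 3
  have := ge_of_tendsto t key
  linarith

/-- The trapezoidal rule is exact for affine functions, so the inequality passes to the difference
`D` between `Y` and a chord. If `D` is positive somewhere, it is positive between the nearest points
on either side where it is nonpositive; there its integral is positive but its trapezoid is not. -/
theorem HermiteHadamardOn.convexOn {Y : ℝ → ℝ} {α β : ℝ} (h : HermiteHadamardOn Y α β)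
    (hY : ContinuousOn Y (Ioo α β)) : ConvexOn ℝ (Ioo α β) Y := by
  refine LinearOrder.convexOn_of_lt (convex_Ioo α β) ?_
  intro x hx y hy hxy p q hp hq hpq
  simp only [smul_eq_mul]
  by_contra! hlt
  set m := p * x + q * y with hm
  set k := (Y y - Y x) / (y - x) with hk
  have hk' : k * (y - x) = Y y - Y x := div_mul_cancel₀ _ (sub_ne_zero.2 hxy.ne')
  obtain rfl : p = 1 - q := by linarith
  have hxm : x < m := by nlinarith
  have hmy : m < y := by nlinarith
  let D : ℝ → ℝ := fun t => Y t - (Y x + k * (t - x))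
  have hsub : Icc x y ⊆ Ioo α β := fun t ht => ⟨hx.1.trans_le ht.1, ht.2.trans_lt hy.2⟩
  have hD : ContinuousOn D (Icc x y) :=
    (hY.mono hsub).sub (Continuous.continuousOn (by fun_prop))
  have hDm : 0 < D m := by
    have : k * (m - x) = q * (Y y - Y x) := by rw [← hk', hm]; ring
    simp only [D, this]
    linarith
  have c₁ : IsCompact (Icc x m ∩ D ⁻¹' Iic 0) :=
    isCompact_Icc.of_isClosed_subset ((hD.mono (Icc_subset_Icc_right hmy.le)).preimage_isClosed_of_isClosed isClosed_Icc
      isClosed_Iic) inter_subset_left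
  have c₂ : IsCompact (Icc m y ∩ D ⁻¹' Iic 0) :=
    isCompact_Icc.of_isClosed_subset ((hD.mono (Icc_subset_Icc_left hxm.le)).preimage_isClosed_of_isClosed isClosed_Icc
      isClosed_Iic) inter_subset_left
  obtain ⟨s, ⟨hs, hDs⟩, hsmax⟩ := c₁.exists_isGreatest ⟨x, ⟨le_rfl, hxm.le⟩, by simp [D]⟩
  obtain ⟨b, ⟨hb, hDb⟩, hbmin⟩ := c₂.exists_isLeast ⟨y, ⟨hmy.le, le_rfl⟩, by simp [D, hk']⟩
  have hDs' : D s ≤ 0 := hDs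
  have hDb' : D b ≤ 0 := hDb
  have hsm : s < m := hs.2.lt_of_ne (by rintro rfl; linarith)
  have hmb : m < b := hb.1.lt_of_ne (by rintro rfl; linarith)
  have hsb := hsm.trans hmb
  have hpos : ∀ t ∈ Ioo s b, 0 < D t := by
    intro t ht
    by_contra! hle
    rcases le_total t m with h' | h'
    · exact absurd (hsmax ⟨⟨hs.1.trans ht.1.le, h'⟩, hle⟩) (not_le.2 ht.1)
    · exact absurd (hbmin ⟨⟨h', ht.2.le.trans hb.2⟩, hle⟩) (not_le.2 ht.2)
  have hsubD : uIcc s b ⊆ Icc x y := by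
    rw [uIcc_of_le hsb.le]
    exact Icc_subset_Icc hs.1 hb.2
  have iD : IntervalIntegrable D volume s b := (hD.mono hsubD).intervalIntegrable
  have iY : IntervalIntegrable Y volume s b := (hY.mono (hsubD.trans hsub)).intervalIntegrable
  have hint := intervalIntegral.intervalIntegral_pos_of_pos_on iD hpos hsb
  have hh := h s b (hx.1.trans_le hs.1) hsb (hb.2.trans_lt hy.2)
  have e : ∫ t in s..b, D t =
      (∫ t in s..b, Y t) - ((b - s) * (Y x - k * x) + k * ((b ^ 2 - s ^ 2) / 2)) := by
    have e' : D = fun t => Y t - ((Y x - k * x) + k * t) := by ext t; simp only [D]; ring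
    rw [e', intervalIntegral.integral_sub iY (Continuous.intervalIntegrable (by fun_prop) _ _),
      intervalIntegral.integral_add (by simp) (Continuous.intervalIntegrable (by fun_prop) _ _),
      intervalIntegral.integral_const, intervalIntegral.integral_const_mul, integral_id,
      smul_eq_mul]
  have : (b - s) * (D s + D b) ≤ 0 :=
    mul_nonpos_of_nonneg_of_nonpos (by linarith) (by linarith)
  simp only [D] at this
  nlinarith

/-! ### Measures with a convex distribution function -/

theorem integral_measureReal_Ioc (μ : Measure ℝ) [IsFiniteMeasure μ] {s b : ℝ} (hsb : s ≤ b) :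
    ∫ u in s..b, μ.real (Ioc s u) = ∫ x in Ioo s b, (b - x) ∂μ := by
  rw [intervalIntegral.integral_of_le hsb, integral_Ioc_eq_integral_Ioo]
  have hint : Integrable (Function.uncurry fun u x : ℝ => (Ici x).indicator (fun _ => (1 : ℝ)) u)
      ((volume.restrict (Ioo s b)).prod (μ.restrict (Ioo s b))) := by
    have : (Function.uncurry fun u x : ℝ => (Ici x).indicator (fun _ => (1 : ℝ)) u) =
        {p : ℝ × ℝ | p.2 ≤ p.1}.indicator fun _ => 1 := by
      ext ⟨u, x⟩
      simp [indicator]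
    rw [this]
    exact (integrable_const 1).indicator (measurableSet_le measurable_snd measurable_fst)
  have swap := integral_integral_swap hint
  have e₁ : ∀ u ∈ Ioo s b, ∫ x in Ioo s b, (Ici x).indicator (fun _ => (1 : ℝ)) u ∂μ =
      μ.real (Ioc s u) := by
    intro u hu
    have : (fun x => (Ici x).indicator (fun _ => (1 : ℝ)) u) = (Iic u).indicator 1 := by
      ext x
      simp [indicator]
    rw [this, integral_indicator_one measurableSet_Iic, measureReal_restrict_apply measurableSet_Iic]
    congr 1
    ext x
    simp only [mem_inter_iff, mem_Iic, mem_Ioo, mem_Ioc]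
    exact ⟨fun h => ⟨h.2.1, h.1⟩, fun h => ⟨h.2, h.1, h.2.trans_lt hu.2⟩⟩
  have e₂ : ∀ x ∈ Ioo s b, ∫ u in Ioo s b, (Ici x).indicator (fun _ => (1 : ℝ)) u = b - x := by
    intro x hx
    have e : Ici x ∩ Ioo s b = Ico x b := by
      ext u
      simp only [mem_inter_iff, mem_Ici, mem_Ioo, mem_Ico]
      exact ⟨fun h => ⟨h.1, h.2.2⟩, fun h => ⟨h.1, hx.1.trans_le h.1, h.2⟩⟩
    have : (Ici x).indicator (fun _ => (1 : ℝ)) = (Ici x).indicator 1 := rfl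
    rw [this, integral_indicator_one measurableSet_Ici, measureReal_restrict_apply measurableSet_Ici,
      e, Real.volume_real_Ico_of_le hx.2.le]
  rw [setIntegral_congr_fun measurableSet_Ioo e₁, setIntegral_congr_fun measurableSet_Ioo e₂]
    at swap
  exact swap

/-- If `μ` has its barycentre in the right half of every interval, then its distribution function
is convex. -/
theorem hermiteHadamardOn_of_barycentre (μ : Measure ℝ) [IsFiniteMeasure μ] {α β : ℝ}
    (h : ∀ s b, α < s → s < b → b < β → ∫ x in Ioo s b, (s + b - 2 * x) ∂μ ≤ 0) :
    HermiteHadamardOn (fun u => μ.real (Iic u)) α β := by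
  intro s b hs hsb hb
  have hY : Monotone fun u => μ.real (Iic u) := fun u v huv => measureReal_mono (Iic_subset_Iic.2 huv)
  have hioc : ∀ u, s ≤ u → μ.real (Ioc s u) = μ.real (Iic u) - μ.real (Iic s) := by
    intro u hu
    rw [← Iic_sdiff_Iic, measureReal_sdiff (Iic_subset_Iic.2 hu) measurableSet_Iic]
  have hb' := h s b hs hsb hb
  have e₁ := integral_measureReal_Ioc μ hsb.le
  have e₂ : ∫ u in s..b, μ.real (Ioc s u) =
      (∫ u in s..b, μ.real (Iic u)) - (b - s) * μ.real (Iic s) := by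
    rw [intervalIntegral.integral_congr (g := fun u => μ.real (Iic u) - μ.real (Iic s)),
      intervalIntegral.integral_sub hY.intervalIntegrable (by simp),
      intervalIntegral.integral_const, smul_eq_mul]
    intro u hu
    rw [uIcc_of_le hsb.le] at hu
    exact hioc u hu.1
  have hi : IntegrableOn (fun x => b - x) (Ioo s b) μ :=
    ((Continuous.integrableOn_Icc (by fun_prop) : IntegrableOn (fun x => b - x) (Icc s b) μ)).mono_set
      Ioo_subset_Icc_self
  have e₃ : ∫ x in Ioo s b, (s + b - 2 * x) ∂μ =
      2 * (∫ x in Ioo s b, (b - x) ∂μ) - (b - s) * μ.real (Ioo s b) := by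
    have : (fun x : ℝ => s + b - 2 * x) = fun x => 2 * (b - x) - (b - s) := by ext; ring
    rw [this, integral_sub (hi.const_mul 2) (integrable_const _), integral_const_mul,
      setIntegral_const, smul_eq_mul, mul_comm (μ.real _)]
  -- A possible atom at `b` is absent from the barycentre hypothesis but counted in the distribution
  -- function; it only enlarges the right-hand side.
  have l : μ.real (Ioo s b) ≤ μ.real (Iic b) - μ.real (Iic s) := by
    rw [← hioc b hsb.le]
    exact measureReal_mono Ioo_subset_Ioc_self
  simp only
  nlinarith [mul_le_mul_of_nonneg_left l (sub_nonneg.2 hsb.le)]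

/-- Countably many rational intervals inside `(α, β)` cover it, so information up to the end points
is not needed. -/
theorem restrict_Ioo_eq_of_Ioc {μ ν : Measure ℝ} [IsFiniteMeasure μ] {α β : ℝ}
    (h : ∀ a b, α < a → a < b → b < β → μ (Ioc a b) = ν (Ioc a b)) :
    μ.restrict (Ioo α β) = ν.restrict (Ioo α β) := by
  have hU : Ioo α β = ⋃ p : {p : ℚ × ℚ // α < p.1 ∧ (p.2 : ℝ) < β},
      Ioc (p.1.1 : ℝ) (p.1.2 : ℝ) := by
    ext x
    simp only [mem_Ioo, mem_iUnion, mem_Ioc, Subtype.exists, Prod.exists]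
    constructor
    · rintro ⟨h₁, h₂⟩
      obtain ⟨p, hp₁, hp₂⟩ := exists_rat_btwn h₁
      obtain ⟨q, hq₁, hq₂⟩ := exists_rat_btwn h₂
      exact ⟨p, q, ⟨hp₁, hq₂⟩, hp₂, hq₁.le⟩
    · rintro ⟨p, q, ⟨h₁, h₂⟩, h₃, h₄⟩
      exact ⟨h₁.trans h₃, h₄.trans_lt h₂⟩
  rw [hU, Measure.restrict_iUnion_congr]
  rintro ⟨⟨p, q⟩, hp, hq⟩
  refine Measure.ext_of_Ioc _ _ fun a b _ => ?_
  rw [Measure.restrict_apply measurableSet_Ioc, Measure.restrict_apply measurableSet_Ioc,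
    Ioc_inter_Ioc]
  rcases lt_or_ge (max a (p : ℝ)) (min b (q : ℝ)) with h' | h'
  · exact h _ _ (hp.trans_le (le_max_right _ _)) h' ((min_le_right _ _).trans_lt hq)
  · simp [Ioc_eq_empty_of_le h']

/-- A finite measure with a convex distribution function on `(α, β)` has a monotone density there. -/
theorem exists_monotone_density (μ : Measure ℝ) [IsFiniteMeasure μ] {α β : ℝ}
    (h : ConvexOn ℝ (Ioo α β) fun u => μ.real (Iic u)) :
    ∃ D : ℝ → ℝ, Measurable D ∧ (∀ x, 0 ≤ D x) ∧ MonotoneOn D (Ioo α β) ∧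
      μ.restrict (Ioo α β) = (volume.restrict (Ioo α β)).withDensity fun x => ENNReal.ofReal (D x) := by
  set Y : ℝ → ℝ := fun u => μ.real (Iic u)
  have hY : Monotone Y := fun u v huv => measureReal_mono (Iic_subset_Iic.2 huv)
  -- The right derivative exists at every interior point of a convex function, so it is monotone on
  -- all of `(α, β)` and the fundamental theorem applies without exceptional points.
  set D : ℝ → ℝ := fun x => derivWithin Y (Ioi x) x
  have hmono : MonotoneOn D (Ioo α β) := by
    have := h.monotoneOn_rightDeriv
    rwa [isOpen_Ioo.interior_eq] at this
  have hD0 : ∀ x, 0 ≤ D x := fun x => (hY.monotoneOn _).derivWithin_nonneg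
  have hDm : Measurable D := measurable_derivWithin_Ioi Y
  refine ⟨D, hDm, hD0, hmono, ?_⟩
  rw [← restrict_withDensity measurableSet_Ioo]
  refine restrict_Ioo_eq_of_Ioc fun a b ha hab hb => ?_
  have hsub : Icc a b ⊆ Ioo α β := fun t ht => ⟨ha.trans_le ht.1, ht.2.trans_lt hb⟩
  have hint : IntervalIntegrable D volume a b := by
    refine MonotoneOn.intervalIntegrable ?_
    rw [uIcc_of_le hab.le]
    exact hmono.mono hsub
  have ftc : ∫ x in a..b, D x = Y b - Y a := by
    refine intervalIntegral.integral_eq_sub_of_hasDeriv_right_of_le hab.le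
      ((h.continuousOn isOpen_Ioo).mono hsub) (fun x hx => ?_) hint
    refine h.hasDerivWithinAt_rightDeriv_of_mem_interior ?_
    rw [isOpen_Ioo.interior_eq]
    exact hsub (Ioo_subset_Icc_self hx)
  rw [withDensity_apply _ measurableSet_Ioc,
    ← ofReal_integral_eq_lintegral_ofReal ((intervalIntegrable_iff_integrableOn_Ioc_of_le hab.le).1 hint)
      (Eventually.of_forall hD0), ← intervalIntegral.integral_of_le hab.le, ftc]
  simp only [Y]
  rw [← measureReal_sdiff (Iic_subset_Iic.2 hab.le) measurableSet_Iic, Iic_sdiff_Iic,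
    ofReal_measureReal]

/-! ### Revenue guarantees that depend only on the marginal -/

theorem Mechanism.revenue_eq_integral (M : Mechanism) {π : Measure (Value × Value)}
    (h : Integrable M.totalPayment π) :
    M.revenue π = ((∫ v, M.totalPayment v ∂π : ℝ) : EReal) := by
  have e : ∀ a b : ENNReal, a ≠ ⊤ → b ≠ ⊤ →
      (a : EReal) - (b : EReal) = ((a.toReal - b.toReal : ℝ) : EReal) := by
    intro a b ha hb
    lift a to NNReal using ha
    lift b to NNReal using hb
    rfl
  rw [integral_eq_lintegral_pos_part_sub_lintegral_neg_part h, Mechanism.revenue]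
  exact e _ _ h.lintegral_lt_top.ne h.neg.lintegral_lt_top.ne

section Marginals

variable {F : Measure Value} {π : Measure (Value × Value)}

theorem isFiniteMeasure_of_mem_jointDistributions [IsFiniteMeasure F]
    (hπ : π ∈ jointDistributions F) : IsFiniteMeasure π := by
  refine ⟨?_⟩
  have := congrArg (fun μ => μ univ) hπ.1
  simp only [Measure.map_apply measurable_fst MeasurableSet.univ, preimage_univ] at this
  rw [this]
  exact measure_lt_top F univ

theorem integrable_add_of_mem_jointDistributions (hπ : π ∈ jointDistributions F) {ψ : Value → ℝ}
    (hψ : Integrable ψ F) : Integrable (fun v => ψ v.1 + ψ v.2) π := by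
  have h₁ : Integrable ψ (π.map Prod.fst) := hπ.1.symm ▸ hψ
  have h₂ : Integrable ψ (π.map Prod.snd) := hπ.2.symm ▸ hψ
  exact (h₁.comp_measurable measurable_fst).add (h₂.comp_measurable measurable_snd)

theorem integral_add_of_mem_jointDistributions (hπ : π ∈ jointDistributions F) {ψ : Value → ℝ}
    (hψ : Integrable ψ F) : ∫ v, (ψ v.1 + ψ v.2) ∂π = 2 * ∫ x, ψ x ∂F := by
  have h₁ : Integrable ψ (π.map Prod.fst) := hπ.1.symm ▸ hψ
  have h₂ : Integrable ψ (π.map Prod.snd) := hπ.2.symm ▸ hψ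
  have e₁ := integral_map measurable_fst.aemeasurable h₁.aestronglyMeasurable
  have e₂ := integral_map measurable_snd.aemeasurable h₂.aestronglyMeasurable
  rw [hπ.1] at e₁
  rw [hπ.2] at e₂
  have i₁ : Integrable (fun v : Value × Value => ψ v.1) π := h₁.comp_measurable measurable_fst
  have i₂ : Integrable (fun v : Value × Value => ψ v.2) π := h₂.comp_measurable measurable_snd
  rw [integral_add i₁ i₂, ← e₁, ← e₂]
  ring

end Marginals

theorem integrable_of_bounded {F : Measure Value} [IsFiniteMeasure F] {φ : Value → ℝ}
    (hφ : Measurable φ) {C : ℝ} (hC : ∀ x, |φ x| ≤ C) : Integrable φ F :=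
  Integrable.of_bound hφ.aestronglyMeasurable C (Eventually.of_forall hC)

theorem totalPayment_le_one {M : Mechanism} (hM : M ∈ dsicEpirMechanisms) (v : Value × Value) :
    M.totalPayment v ≤ 1 := by
  obtain ⟨hf, -, hr⟩ := hM
  have h₁ := hr.bidder₁ v.1 v.2
  have h₂ := hr.bidder₂ v.1 v.2
  have h₃ := mul_le_of_le_one_left (hf.q₁_nonneg v) v.1.2.2
  have h₄ := mul_le_of_le_one_left (hf.q₂_nonneg v) v.2.2.2
  have h₅ := hf.q_sum_le_one v
  simp only [Mechanism.totalPayment, Prod.mk.eta] at *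
  linarith

theorem uniformReserveSPA_totalPayment (v : Value × Value) :
    uniformReserveSPA.totalPayment v = (v.1 : ℝ) ^ 2 / 2 + (v.2 : ℝ) ^ 2 / 2 := by
  simp only [Mechanism.totalPayment, uniformReserveSPA]
  rcases lt_trichotomy v.1 v.2 with h | h | h
  · simp only [h, h.not_gt, if_true, if_false]; ring
  · simp only [h, lt_irrefl, if_false]
  · simp only [h, h.not_gt, if_true, if_false]; ring

/-- A mechanism whose revenue dominates `φ v₁ + φ v₂` guarantees twice the mean of `φ`. -/
theorem two_mul_integral_le {F : Measure Value} [IsProbabilityMeasure F]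
    (hmax : IsMaxminAuction F uniformReserveSPA) {M : Mechanism} (hM : M ∈ dsicEpirMechanisms)
    {φ : Value → ℝ} (hφ : Measurable φ) {C : ℝ} (hC : ∀ x, |φ x| ≤ C)
    (h : ∀ v, φ v.1 + φ v.2 ≤ M.totalPayment v) :
    2 * ∫ x, φ x ∂F ≤ ∫ x, (x : ℝ) ^ 2 ∂F := by
  have hiφ : Integrable φ F := integrable_of_bounded hφ hC
  have hsq : Integrable (fun x : Value => (x : ℝ) ^ 2 / 2) F := by
    refine integrable_of_bounded (by fun_prop) (C := 1) fun x => ?_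
    rw [abs_le]
    constructor <;> nlinarith [x.2.1, x.2.2]
  have lower : ((2 * ∫ x, φ x ∂F : ℝ) : EReal) ≤ worstCaseRevenue F M := by
    refine le_iInf₂ fun π hπ => ?_
    have := isFiniteMeasure_of_mem_jointDistributions hπ
    -- Payments are bounded above by EPIR and feasibility and below by `φ`, so the extended-real
    -- revenue is an ordinary integral.
    have hint : Integrable M.totalPayment π := by
      refine Integrable.of_bound (C := 1 + 2 * C) (Measurable.aestronglyMeasurable
        (hM.1.measurable_t₁.add hM.1.measurable_t₂)) (Eventually.of_forall fun v => ?_)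
      have h₀ := (abs_nonneg _).trans (hC v.1)
      have h₁ := (abs_le.1 (hC v.1)).1
      have h₂ := (abs_le.1 (hC v.2)).1
      have h₃ := totalPayment_le_one hM v
      have h₄ := h v
      rw [Real.norm_eq_abs, abs_le]
      constructor <;> linarith
    rw [M.revenue_eq_integral hint, EReal.coe_le_coe_iff,
      ← integral_add_of_mem_jointDistributions hπ hiφ]
    exact integral_mono (integrable_add_of_mem_jointDistributions hπ hiφ) hint h
  have upper : worstCaseRevenue F uniformReserveSPA ≤ ((∫ x, (x : ℝ) ^ 2 ∂F : ℝ) : EReal) := by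
    -- Any coupling would serve here, since the benchmark revenue is additive; independence is the
    -- explicit choice.
    have hπ : F.prod F ∈ jointDistributions F := by
      constructor <;> simp
    refine (iInf₂_le (F.prod F) hπ).trans ?_
    have e : uniformReserveSPA.totalPayment = fun v => (v.1 : ℝ) ^ 2 / 2 + (v.2 : ℝ) ^ 2 / 2 :=
      funext uniformReserveSPA_totalPayment
    rw [Mechanism.revenue_eq_integral, e, EReal.coe_le_coe_iff,
      integral_add_of_mem_jointDistributions hπ hsq, integral_div]
    · linarith
    · rw [e]
      exact integrable_add_of_mem_jointDistributions hπ hsq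
  exact EReal.coe_le_coe_iff.1 (lower.trans ((hmax.2 M hM).trans upper))

/-! ### Necessary conditions from the two families of deviations -/

theorem integrable_sq (F : Measure Value) [IsFiniteMeasure F] :
    Integrable (fun x : Value => (x : ℝ) ^ 2) F := by
  refine integrable_of_bounded (by fun_prop) (C := 1) fun x => ?_
  rw [abs_le]
  constructor <;> nlinarith [x.2.1, x.2.2]

theorem abs_revenueShift_le {s b x : ℝ} (hs : 0 ≤ s) (hb : b ≤ 1) : |revenueShift s b x| ≤ 1 := by
  unfold revenueShift
  split_ifs with h
  · have h₁ : 0 ≤ x ^ 2 := sq_nonneg x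
    have h₂ : x ^ 2 ≤ 1 := by nlinarith [h.1, h.2]
    have h₃ : |s + b - 2 * x| ≤ 1 := by
      rw [abs_le]
      constructor <;> linarith [h.1, h.2]
    rw [abs_mul, abs_of_nonneg h₁]
    exact mul_le_one₀ h₂ (abs_nonneg _) h₃
  · simp

theorem integral_revenueShift_nonpos {F : Measure Value} [IsProbabilityMeasure F]
    (hmax : IsMaxminAuction F uniformReserveSPA) {s b : ℝ} (hs : 0 ≤ s) (hsb : s < b)
    (hb : b ≤ 1) : ∫ x : Value, revenueShift s b x ∂F ≤ 0 := by
  have hm : Measurable fun x : Value => revenueShift s b x :=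
    (measurable_revenueShift s b).comp measurable_subtype_coe
  have hi : Integrable (fun x : Value => revenueShift s b x) F :=
    integrable_of_bounded hm fun x => abs_revenueShift_le hs hb
  have key := two_mul_integral_le hmax (lowBidder_mem hs hsb hb)
    (φ := fun x => (x : ℝ) ^ 2 / 2 + revenueShift s b x / 6) (by fun_prop) (C := 2) (fun x => ?_)
    fun v => (lowBidder_totalPayment s b v).ge
  · rw [integral_add ((integrable_sq F).div_const 2) (hi.div_const 6), integral_div,
      integral_div] at key
    linarith
  · have h := abs_le.1 (abs_revenueShift_le (x := x) hs hb)
    rw [abs_le]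
    constructor <;> nlinarith [x.2.1, x.2.2, h.1, h.2]

/-- The mass condition: the atom at `1` is worth at least the second moment below `1`. -/
theorem setIntegral_sq_le {F : Measure Value} [IsProbabilityMeasure F]
    (hmax : IsMaxminAuction F uniformReserveSPA) :
    ∫ x in Ioo (0 : Value) 1, (x : ℝ) ^ 2 ∂F ≤ F.real {1} := by
  -- Twice the gain per bidder from the reserve on `[0, r]`, divided by `1 - r`. It is bounded by
  -- `1`, and as `r ↑ 1` it tends to `x²` for `x < 1` and to `-1` at `x = 1`.
  let H : ℝ → Value → ℝ := fun r x => (min ((x : ℝ) ^ 2 / r) r - (x : ℝ) ^ 2) / (1 - r)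
  have hlt : ∀ᶠ r : ℝ in 𝓝[<] 1, r < 1 := self_mem_nhdsWithin
  have hpos : ∀ᶠ r : ℝ in 𝓝[<] 1, 0 < r := nhdsWithin_le_nhds (Ioi_mem_nhds one_pos)
  have hbound : ∀ r : ℝ, 0 < r → r < 1 → ∀ x : Value, |H r x| ≤ 1 := by
    intro r hr hr1 x
    obtain ⟨hx0, hx1⟩ := x.2
    have h1r : 0 < 1 - r := by linarith
    simp only [H]
    rw [abs_div, abs_of_pos h1r, div_le_one h1r, abs_le]
    constructor
    · have : r - 1 + (x : ℝ) ^ 2 ≤ min ((x : ℝ) ^ 2 / r) r := by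
        refine le_min ?_ (by nlinarith)
        rw [le_div_iff₀ hr]
        nlinarith [mul_nonneg hx0 hx0, mul_le_mul hx1 hx1 hx0 zero_le_one]
      linarith
    · rcases le_or_gt ((x : ℝ)) r with h | h
      · have e : (x : ℝ) ^ 2 / r - (x : ℝ) ^ 2 = (x : ℝ) ^ 2 / r * (1 - r) := by field_simp
        have : (x : ℝ) ^ 2 / r ≤ 1 := by
          rw [div_le_one hr]
          nlinarith
        nlinarith [min_le_left ((x : ℝ) ^ 2 / r) r]
      · nlinarith [min_le_right ((x : ℝ) ^ 2 / r) r]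
  have hm : ∀ r, Measurable (H r) := fun r => by fun_prop
  have hle : ∀ᶠ r in 𝓝[<] 1, ∫ x, H r x ∂F ≤ 0 := by
    filter_upwards [hlt, hpos] with r hr1 hr
    have hmin : ∀ x : ℝ, min (x ^ 2 / (2 * r)) (r / 2) = min (x ^ 2 / r) r / 2 := by
      intro x
      rw [← min_div_div_right (by norm_num : (0 : ℝ) ≤ 2), div_div, mul_comm r]
    have hb : ∀ x : Value, |min ((x : ℝ) ^ 2 / r) r / 2| ≤ 1 := by
      intro x
      have : 0 ≤ min ((x : ℝ) ^ 2 / r) r := le_min (by positivity) hr.le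
      rw [abs_of_nonneg (by positivity)]
      linarith [min_le_right ((x : ℝ) ^ 2 / r) r]
    have key := two_mul_integral_le hmax (shortReserve_mem hr)
      (φ := fun x => min ((x : ℝ) ^ 2 / r) r / 2) (by fun_prop) hb fun v => by
        have := shortReserve_totalPayment hr v
        rwa [hmin, hmin] at this
    have hi : Integrable (fun x : Value => min ((x : ℝ) ^ 2 / r) r) F := by
      have := (integrable_of_bounded (F := F) (by fun_prop) hb).mul_const 2
      simpa using this
    simp only [H]
    rw [integral_div, integral_sub hi (integrable_sq F)]
    rw [integral_div] at key
    exact div_nonpos_of_nonpos_of_nonneg (by linarith) (by linarith)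
  have hlim : Tendsto (fun r => ∫ x, H r x ∂F) (𝓝[<] 1)
      (𝓝 (∫ x, ((Ioo (0 : Value) 1).indicator (fun x => (x : ℝ) ^ 2) x -
        ({1} : Set Value).indicator 1 x) ∂F)) := by
    refine tendsto_integral_filter_of_dominated_convergence (fun _ => 1)
      (Eventually.of_forall fun r => (hm r).aestronglyMeasurable) ?_ (integrable_const 1)
      (Eventually.of_forall fun x => ?_)
    · filter_upwards [hlt, hpos] with r hr1 hr
      exact Eventually.of_forall (hbound r hr hr1)
    · rcases eq_or_lt_of_le (unitInterval.le_one' : x ≤ 1) with rfl | hx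
      · refine tendsto_const_nhds.congr' ?_
        filter_upwards [hlt, hpos] with r hr1 hr
        have : min (1 / r) r = r := min_eq_right (hr1.le.trans ((one_le_div hr).2 hr1.le))
        have h' : 1 - r ≠ 0 := by linarith
        simp only [H, Set.Icc.coe_one, one_pow, this, mem_Ioo, lt_irrefl, and_false,
          not_false_eq_true, indicator_of_notMem, mem_singleton_iff, indicator_of_mem, Pi.one_apply]
        field_simp
        ring
      · have e : (Ioo (0 : Value) 1).indicator (fun x => (x : ℝ) ^ 2) x -
            ({1} : Set Value).indicator 1 x = (x : ℝ) ^ 2 / 1 := by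
          rw [indicator_of_notMem (s := {1}) (by simpa using hx.ne)]
          rcases eq_or_lt_of_le (unitInterval.nonneg' : 0 ≤ x) with rfl | h0
          · simp
          · rw [indicator_of_mem (show x ∈ Ioo (0 : Value) 1 from ⟨h0, hx⟩)]
            ring
        rw [e]
        have t : Tendsto (fun r : ℝ => (x : ℝ) ^ 2 / r) (𝓝[<] 1) (𝓝 ((x : ℝ) ^ 2 / 1)) :=
          (tendsto_const_nhds.div tendsto_id one_ne_zero).mono_left nhdsWithin_le_nhds
        refine t.congr' ?_
        have hx' : (x : ℝ) < 1 := hx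
        have hxr : ∀ᶠ r : ℝ in 𝓝[<] 1, (x : ℝ) < r := nhdsWithin_le_nhds (Ioi_mem_nhds hx')
        filter_upwards [hlt, hpos, hxr] with r hr1 hr hxr
        have h' : 1 - r ≠ 0 := by linarith
        have : (x : ℝ) ^ 2 / r ≤ r := by
          rw [div_le_iff₀ hr]
          nlinarith [x.2.1]
        simp only [H, min_eq_left this]
        field_simp
  have := le_of_tendsto hlim hle
  have hi : Integrable (({1} : Set Value).indicator (1 : Value → ℝ)) F :=
    (integrable_const (1 : ℝ)).indicator (measurableSet_singleton 1)
  rw [integral_sub ((integrable_sq F).indicator measurableSet_Ioo) hi,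
    integral_indicator measurableSet_Ioo, integral_indicator_one (measurableSet_singleton 1)] at this
  linarith

/-! ### Transfer to the real line and conclusion -/

theorem map_withDensity_comp {α γ : Type*} [MeasurableSpace α] [MeasurableSpace γ] (μ : Measure α)
    {e : α → γ} (he : Measurable e) {h : γ → ENNReal} (hh : Measurable h) :
    (μ.withDensity fun x => h (e x)).map e = (μ.map e).withDensity h := by
  ext t ht
  rw [Measure.map_apply he ht, withDensity_apply _ (he ht), withDensity_apply _ ht,
    setLIntegral_map ht hh he]

theorem isInteriorDensity_of_map {F : Measure Value} {f : ℝ → ℝ} (hf : Measurable f)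
    (hf0 : ∀ x, 0 ≤ f x)
    (h : (F.map Subtype.val).restrict (Ioo 0 1) =
      (volume.restrict (Ioo 0 1)).withDensity fun x => ENNReal.ofReal (f x)) :
    IsInteriorDensity F fun x => f x := by
  refine ⟨hf.comp measurable_subtype_coe, fun x => hf0 x, ?_⟩
  have emb : MeasurableEmbedding (Subtype.val : Value → ℝ) :=
    MeasurableEmbedding.subtype_coe measurableSet_Icc
  have pre : (Subtype.val : Value → ℝ) ⁻¹' Ioo 0 1 = Ioo 0 1 := by
    ext x
    rfl
  rw [← emb.comap_map (F.restrict (Ioo 0 1)),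
    ← emb.comap_map ((volume.restrict (Ioo 0 1)).withDensity _)]
  congr 1
  rw [map_withDensity_comp _ emb.measurable (h := fun x => ENNReal.ofReal (f x)) (by fun_prop),
    ← pre, ← Measure.restrict_map emb.measurable measurableSet_Ioo,
    ← Measure.restrict_map emb.measurable measurableSet_Ioo,
    unitInterval.measurePreserving_coe.map_eq, Measure.restrict_restrict measurableSet_Ioo,
    inter_eq_left.2 Ioo_subset_Icc_self, h]

end RobustAuction

open RobustAuction in
theorem proposition3 (F : MeasureTheory.Measure RobustAuction.Value)
    [MeasureTheory.IsProbabilityMeasure F]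
    (hmaxmin : RobustAuction.IsMaxminAuction F RobustAuction.uniformReserveSPA) :
    RobustAuction.RobustRegularAlmostSurely F := by
  have hsqm : Measurable fun x : ℝ => ENNReal.ofReal (x ^ 2) := by fun_prop
  set G : Measure ℝ := F.map Subtype.val with hG
  set μ : Measure ℝ := G.withDensity fun x => ENNReal.ofReal (x ^ 2) with hμ
  have hfin : IsFiniteMeasure μ := by
    refine isFiniteMeasure_withDensity_ofReal (Integrable.hasFiniteIntegral ?_)
    exact (integrable_map_measure (by fun_prop) (by fun_prop)).2 (integrable_sq F)
  have hbary : ∀ s b, 0 < s → s < b → b < 1 → ∫ x in Ioo s b, (s + b - 2 * x) ∂μ ≤ 0 := by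
    intro s b hs hsb hb
    refine le_of_eq_of_le ?_ (integral_revenueShift_nonpos hmaxmin hs.le hsb hb.le)
    rw [setIntegral_withDensity_eq_setIntegral_toReal_smul hsqm (by simp) _ measurableSet_Ioo,
      ← integral_indicator measurableSet_Ioo, hG]
    rw [integral_map (by fun_prop) (Measurable.aestronglyMeasurable
      (Measurable.indicator (by fun_prop) measurableSet_Ioo))]
    refine integral_congr_ae (Filter.Eventually.of_forall fun x => ?_)
    simp only [revenueShift, indicator, mem_Ioo, smul_eq_mul, ENNReal.toReal_ofReal (sq_nonneg _)]
  have hHH := hermiteHadamardOn_of_barycentre μ hbary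
  obtain ⟨D, hDm, hD0, hDmono, hD⟩ := exists_monotone_density μ
    (hHH.convexOn (hHH.continuousOn fun u v huv => measureReal_mono (Iic_subset_Iic.2 huv)))
  -- The weight `x²` is positive and finite on `(0, 1)`, so it can be divided out of the density of
  -- `μ`.
  have hGD : G.restrict (Ioo 0 1) =
      (volume.restrict (Ioo 0 1)).withDensity fun x => ENNReal.ofReal (D x / x ^ 2) := by
    have e := congrArg (fun m : Measure ℝ => m.withDensity (fun x => ENNReal.ofReal (x ^ 2))⁻¹) hD
    simp only [hμ] at e
    have hne : ∀ᵐ x ∂G.restrict (Ioo 0 1), ENNReal.ofReal (x ^ 2) ≠ 0 := by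
      filter_upwards [ae_restrict_mem measurableSet_Ioo] with x hx
      simpa using hx.1.ne'
    have hinv : ((G.restrict (Ioo 0 1)).withDensity fun x => ENNReal.ofReal (x ^ 2)).withDensity
        (fun x => ENNReal.ofReal (x ^ 2))⁻¹ = G.restrict (Ioo 0 1) :=
      withDensity_inv_same hsqm hne (by simp)
    rw [restrict_withDensity measurableSet_Ioo, hinv,
      ← withDensity_mul _ (by fun_prop) hsqm.inv] at e
    rw [e]
    refine withDensity_congr_ae ?_
    filter_upwards [ae_restrict_mem measurableSet_Ioo] with x hx
    have : 0 < x ^ 2 := pow_pos hx.1 2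
    simp only [Pi.mul_apply, Pi.inv_apply]
    rw [ENNReal.ofReal_div_of_pos this, div_eq_mul_inv]
  have hdens := isInteriorDensity_of_map (F := F) (f := fun x => D x / x ^ 2) (by fun_prop)
    (fun x => div_nonneg (hD0 x) (sq_nonneg x)) hGD
  have hmul : ∀ x ∈ Ioo (0 : Value) 1, (x : ℝ) ^ 2 * (D x / (x : ℝ) ^ 2) = D x := by
    intro x hx
    have : (x : ℝ) ≠ 0 := (show (0 : ℝ) < x from hx.1).ne'
    field_simp
  refine ⟨_, hdens, ⟨fun x hx y hy hxy => ?_, ?_⟩⟩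
  · simp only [hmul x hx, hmul y hy]
    exact hDmono hx hy hxy
  -- With `f = D / x²` as density, `∫ x² f dx` is the second moment of `F` on `(0, 1)`, which the
  -- mass condition bounds.
  · have e : ∫⁻ x in Ioo (0 : Value) 1, ENNReal.ofReal ((x : ℝ) ^ 2 * (D x / (x : ℝ) ^ 2)) =
        ∫⁻ x in Ioo (0 : Value) 1, ENNReal.ofReal ((x : ℝ) ^ 2) ∂F := by
      rw [hdens.restrict_eq, lintegral_withDensity_eq_lintegral_mul _ (by fun_prop) (by fun_prop)]
      refine lintegral_congr fun x => ?_
      rw [ENNReal.ofReal_mul (sq_nonneg _), Pi.mul_apply, mul_comm]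
    rw [e, ← ofReal_integral_eq_lintegral_ofReal (integrable_sq F).integrableOn
      (Filter.Eventually.of_forall fun x => sq_nonneg _)]
    exact ENNReal.ofReal_le_of_le_toReal (setIntegral_sq_le hmaxmin)
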